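/- Let $h=(h_1,\dots,h_{m_1})$ and $g=(g_1,\dots,g_{m_2})$ be tuples of polynomials in $\mathbb{R}[x]=\mathbb{R}[x_1,\dots,x_n]$ such that $K=\{x\in\mathbb{R}^n : h(x)=0,\ g(x)\ge 0\}$ is nonempty. Let $I(h)$ be the ideal generated by $h$ and let $Q(g)=\{\sigma_0+\sum_j g_j\sigma_j : \sigma_0,\dots,\sigma_{m_2} \text{ sums of squares of polynomials}\}$. Suppose that $I(h)+Q(g)$ is archimedean, i.e. $R-\|x\|_2^2\in I(h)+Q(g)$ for some $R>0$. Let $\mathcal{A}\subseteq\mathbb{N}^n$ be finite, let $\mathbb{R}[x]_{\mathcal{A}}=\mathrm{span}\{x^\alpha:\alpha\in\mathcal{A}\}$, and for $p=\sum_\alpha p_\alpha x^\alpha\in\mathbb{R}[x]_{\mathcal{A}}$ and $y\in\mathbb{R}^{\mathcal{A}}$ put $\langle p,y\rangle=\sum_{\alpha\in\mathcal{A}}p_\alpha y_\alpha$. Let $\mathscr{R}_{\mathcal{A}}(K)$ be the set of all $y\in\mathbb{R}^{\mathcal{A}}$ for which there is a Borel measure $\mu$ supported in $K$ with $y_\alpha=\int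 x^\alpha\,d\mu$ for all $\alpha\in\mathcal{A}$. For $k\in\mathbb{N}$ let $\mathbb{N}^n_{2k}=\{\alpha\in\mathbb{N}^n:|\alpha|\le 2k\}$. For $z\in\mathbb{R}^{\mathbb{N}^n_{2k}}$ and a polynomial $q$, let $L_q^{(k)}(z)$ be the matrix with entries $\langle q\,x^{\alpha+\beta},z\rangle$, whose rows and columns are indexed by the $\alpha,\beta\in\mathbb{N}^n$ with $\deg(q)+2|\alpha|\le 2k$ and $\deg(q)+2|\beta|\le 2k$. Let $\mathscr{S}^k_{\mathcal{A}}(K)$ be the set of all restrictions $z|_{\mathcal{A}}$ of those $z\in\mathbb{R}^{\mathbb{N}^n_{2k}}$ for which $L_{h_i}^{(k)}(z)=0$ for all $i$, $L_1^{(k)}(z)\succeq 0$, and $L_{g_j}^{(k)}(z)\succeq 0$ for all $j$; if $\mathcal{A}\not\subseteq\mathbb{N}^n_{2k}$, then $\mathscr{S}^k_{\mathcal{A}}(K)=\mathbb{R}^{\mathcal{A}}$ by convention. Let $f\in\mathbb{R}[x]_{\mathcal{A}}$ be positive on $K$, and put $$\mathscr{S}^k_{\mathcal{A}}(K,f)=\{y\in\mathscr{S}^k_{\mathcal{A}}(K):\langle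 f,y\rangle=1\},\qquad \mathscr{R}_{\mathcal{A}}(K,f)=\{y\in\mathscr{R}_{\mathcal{A}}(K):\langle f,y\rangle=1\}.$$ Then every $z\in\mathbb{R}^{\mathcal{A}}$ has a nearest point in $\mathscr{R}_{\mathcal{A}}(K,f)$ with respect to $\|\cdot\|_2$, and $$\mathrm{dist}\big(\mathscr{S}^k_{\mathcal{A}}(K,f),\mathscr{R}_{\mathcal{A}}(K,f)\big):=\sup_{z\in\mathscr{S}^k_{\mathcal{A}}(K,f)}\ \min_{y\in\mathscr{R}_{\mathcal{A}}(K,f)}\|z-y\|_2\ \in[0,\infty]$$ tends to $0$ as $k\to\infty$. -/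

import Mathlib

namespace MomentCone

open MvPolynomial MeasureTheory

noncomputable section

/-- The set `K = {x ∈ ℝⁿ : h(x) = 0, g(x) ≥ 0}`. -/
def semialgSet {n m₁ m₂ : ℕ} (h : Fin m₁ → MvPolynomial (Fin n) ℝ)
    (g : Fin m₂ → MvPolynomial (Fin n) ℝ) : Set (Fin n → ℝ) :=
  {x | (∀ i, eval x (h i) = 0) ∧ ∀ j, 0 ≤ eval x (g j)}

/-- The ideal `I(h)` generated by the tuple `h`. -/
def idealGen {n m₁ : ℕ} (h : Fin m₁ → MvPolynomial (Fin n) ℝ) :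
    Ideal (MvPolynomial (Fin n) ℝ) :=
  Ideal.span (Set.range h)

/-- The quadratic module `Q(g)` generated by the tuple `g`: all polynomials
`σ₀ + g₁ σ₁ + ⋯ + g_m σ_m` with every `σ_j` a sum of squares of polynomials. -/
def quadModule {n m₂ : ℕ} (g : Fin m₂ → MvPolynomial (Fin n) ℝ) :
    Set (MvPolynomial (Fin n) ℝ) :=
  {p | ∃ (σ₀ : MvPolynomial (Fin n) ℝ) (σ : Fin m₂ → MvPolynomial (Fin n) ℝ),
    IsSumSq σ₀ ∧ (∀ j, IsSumSq (σ j)) ∧ p = σ₀ + ∑ j, g j * σ j}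

/-- `I(h) + Q(g)` is archimedean: `R - ‖x‖₂² ∈ I(h) + Q(g)` for some `R > 0`. -/
def IsArchimedean {n m₁ m₂ : ℕ} (h : Fin m₁ → MvPolynomial (Fin n) ℝ)
    (g : Fin m₂ → MvPolynomial (Fin n) ℝ) : Prop :=
  ∃ R : ℝ, 0 < R ∧ ∃ p ∈ idealGen h, ∃ q ∈ quadModule g,
    (C R - ∑ i, X i ^ 2 : MvPolynomial (Fin n) ℝ) = p + q

/-- `ℝ[x]_A`, the span of the monomials `x^α` with `α ∈ A`. -/
def polySpan {n : ℕ} (A : Finset (Fin n →₀ ℕ)) : Submodule ℝ (MvPolynomial (Fin n) ℝ) :=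
  Submodule.span ℝ ((fun α => monomial α (1 : ℝ)) '' (A : Set (Fin n →₀ ℕ)))

/-- `ℝ^A`, the space of `A`-truncated moment sequences, with the Euclidean norm. -/
abbrev Tms {n : ℕ} (A : Finset (Fin n →₀ ℕ)) : Type := EuclideanSpace ℝ A

/-- The pairing `⟨p, y⟩ = ∑_{α ∈ A} p_α y_α` (meant for `p ∈ ℝ[x]_A`). -/
def riesz {n : ℕ} {A : Finset (Fin n →₀ ℕ)} (p : MvPolynomial (Fin n) ℝ) (y : Tms A) : ℝ :=
  ∑ α : A, coeff (α : Fin n →₀ ℕ) p * y α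

/-- `ℕ^n_d = {α ∈ ℕ^n : |α| ≤ d}`. -/
def expUpTo (n d : ℕ) : Finset (Fin n →₀ ℕ) :=
  (Finsupp.finite_of_degree_le (σ := Fin n) d).toFinset

/-- The restriction `z|_A` of a truncated moment sequence. -/
def restrict {n : ℕ} {A B : Finset (Fin n →₀ ℕ)} (hAB : A ⊆ B) (z : Tms B) : Tms A :=
  WithLp.toLp 2 fun α => z ⟨α, hAB α.2⟩

/-- The row and column indices of the `k`-th localizing matrix of `q`: the exponents `α` with
`deg(q) + 2|α| ≤ 2k` (none if `deg(q) > 2k`). -/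
def locIndex {n : ℕ} (q : MvPolynomial (Fin n) ℝ) (k : ℕ) : Finset (Fin n →₀ ℕ) :=
  (expUpTo n k).filter fun α => q.totalDegree + 2 * α.degree ≤ 2 * k

/-- The `k`-th order localizing matrix `L_q^{(k)}(z)`, with entries `⟨q x^{α+β}, z⟩`; it is the
symmetric matrix with `⟨q p², z⟩ = pᵀ L_q^{(k)}(z) p` for all `p` with `deg(q p²) ≤ 2k`. -/
def locMatrix {n : ℕ} (q : MvPolynomial (Fin n) ℝ) (k : ℕ) (z : Tms (expUpTo n (2 * k))) :
    Matrix (locIndex q k) (locIndex q k) ℝ :=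
  Matrix.of fun α β => riesz (q * monomial ((α : Fin n →₀ ℕ) + (β : Fin n →₀ ℕ)) (1 : ℝ)) z

/-- `Φ_k(g)`: the localizing matrices of `g₀ = 1` and of all `g_j` are positive semidefinite. -/
def Phi {n m₂ : ℕ} (g : Fin m₂ → MvPolynomial (Fin n) ℝ) (k : ℕ) :
    Set (Tms (expUpTo n (2 * k))) :=
  {z | (locMatrix 1 k z).PosSemidef ∧ ∀ j, (locMatrix (g j) k z).PosSemidef}

/-- `E_k(h)`: the localizing matrices of all `h_i` vanish. -/
def Eset {n m₁ : ℕ} (h : Fin m₁ → MvPolynomial (Fin n) ℝ) (k : ℕ) :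
    Set (Tms (expUpTo n (2 * k))) :=
  {z | ∀ i, locMatrix (h i) k z = 0}

/-- The semidefinite relaxation `S_A^k(K)`: all restrictions `z|_A` with `z ∈ Φ_k(g) ∩ E_k(h)`;
it is all of `ℝ^A` if `A` is not contained in `ℕ^n_{2k}`, that is, if `k < deg(A)/2`. -/
def relaxCone {n m₁ m₂ : ℕ} (A : Finset (Fin n →₀ ℕ)) (h : Fin m₁ → MvPolynomial (Fin n) ℝ)
    (g : Fin m₂ → MvPolynomial (Fin n) ℝ) (k : ℕ) : Set (Tms A) :=
  {y | ∀ hA : A ⊆ expUpTo n (2 * k), ∃ z ∈ Phi g k ∩ Eset h k, restrict hA z = y}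

/-- The Borel measure `μ` is supported in `K` and represents `y`, i.e. `y_α = ∫ x^α dμ` for all
`α ∈ A` (in particular these integrals exist). -/
def IsRepresenting {n : ℕ} {A : Finset (Fin n →₀ ℕ)} (K : Set (Fin n → ℝ)) (y : Tms A)
    (μ : Measure (Fin n → ℝ)) : Prop :=
  μ Kᶜ = 0 ∧ ∀ α : A,
    Integrable (fun x : Fin n → ℝ => ∏ i, x i ^ (α : Fin n →₀ ℕ) i) μ ∧
      y α = ∫ x : Fin n → ℝ, ∏ i, x i ^ (α : Fin n →₀ ℕ) i ∂μ

/-- The moment cone `R_A(K)`: all `A`-truncated moment sequences that admit a `K`-measure. -/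
def momentCone {n : ℕ} (A : Finset (Fin n →₀ ℕ)) (K : Set (Fin n → ℝ)) : Set (Tms A) :=
  {y | ∃ μ : Measure (Fin n → ℝ), IsRepresenting K y μ}

/-- The section `{y ∈ S : ⟨f, y⟩ = 1}` of a set `S ⊆ ℝ^A`. -/
def normalize {n : ℕ} {A : Finset (Fin n →₀ ℕ)} (S : Set (Tms A))
    (f : MvPolynomial (Fin n) ℝ) : Set (Tms A) :=
  {y | y ∈ S ∧ riesz f y = 1}

/-- The one-sided Hausdorff distance `sup_{z ∈ S} inf_{y ∈ T} ‖z - y‖₂`, with values in `[0, ∞]`. -/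
def oneSidedDist {n : ℕ} {A : Finset (Fin n →₀ ℕ)} (S T : Set (Tms A)) : ENNReal :=
  ⨆ z ∈ S, ⨅ y ∈ T, ENNReal.ofReal ‖z - y‖

end

end MomentCone

/-! ### Quadratic modules and their bounded elements -/

namespace MomentCone

/-! Archimedeanness makes `K` compact, so the normalized moment cone is the convex hull of the
compact set of normalized point evaluations (`normalize_momentCone_eq`). It is therefore compact,
and nearest points exist. By separation, it is cut out of the hyperplane `⟨f, y⟩ = 1` by the
inequalities `⟨p, y⟩ ≥ 0`, with `p` running over the polynomials in `ℝ[x]_A` that are positive on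
`K` (`mem_convexHull_normalizedMonomials`).

Putinar's theorem puts each such `p` in `I(h) + Q(g)`, and a fixed certificate is seen by all
relaxations of high enough order, so each single inequality eventually holds on the relaxation
(`IsArchimedean.eventually_riesz_nonneg`). Applied to `c f ± x^α`, this bounds the normalized
relaxations uniformly. The points of that bounded region at distance at least `r` from the moment
section form a compact set on which finitely many inequalities already fail jointly. Once those
finitely many hold, no relaxation point is that far away (`eventually_infDist_normalize_lt`).

Putinar's theorem itself is obtained from states: an element outside an archimedean quadratic module
is nonpositive at some state, hence at an extreme state minimizing it. Extreme states are
multiplicative, and for polynomials they are evaluations at points of `K`. -/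

/-- A quadratic module of a commutative ring: it contains `1` and is closed under addition and
under multiplication by squares. -/
structure IsQuadraticModule {A : Type*} [CommRing A] (M : Set A) : Prop where
  one_mem : (1 : A) ∈ M
  add_mem : ∀ {a b : A}, a ∈ M → b ∈ M → a + b ∈ M
  sq_mul_mem : ∀ (a : A) {b : A}, b ∈ M → a ^ 2 * b ∈ M

namespace IsQuadraticModule

section Basic

variable {A : Type*} [CommRing A] {M : Set A}

theorem sq_mem (hM : IsQuadraticModule M) (a : A) : a ^ 2 ∈ M := by
  simpa using hM.sq_mul_mem a hM.one_mem

theorem zero_mem (hM : IsQuadraticModule M) : (0 : A) ∈ M := by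
  simpa using hM.sq_mem 0

variable [Algebra ℝ A]

theorem smul_mem (hM : IsQuadraticModule M) {r : ℝ} (hr : 0 ≤ r) {a : A} (ha : a ∈ M) :
    r • a ∈ M := by
  have h := hM.sq_mul_mem (algebraMap ℝ A (Real.sqrt r)) ha
  rwa [← map_pow, Real.sq_sqrt hr, ← Algebra.smul_def] at h

theorem algebraMap_mem (hM : IsQuadraticModule M) {r : ℝ} (hr : 0 ≤ r) : algebraMap ℝ A r ∈ M := by
  simpa [Algebra.smul_def] using hM.smul_mem hr hM.one_mem

/-- The elements of `A` that are bounded by a real constant with respect to a quadratic module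
form a subalgebra. -/
def boundedSubalgebra (hM : IsQuadraticModule M) : Subalgebra ℝ A :=
  have hsq : ∀ a : A, (∃ N : ℝ, 0 < N ∧ algebraMap ℝ A N - a ∈ M ∧ algebraMap ℝ A N + a ∈ M) →
      ∃ N : ℝ, 0 < N ∧ algebraMap ℝ A N - a ^ 2 ∈ M ∧ algebraMap ℝ A N + a ^ 2 ∈ M := by
    rintro a ⟨N, hN, h₁, h₂⟩
    refine ⟨N ^ 2, by positivity, ?_,
      hM.add_mem (hM.algebraMap_mem (by positivity)) (hM.sq_mem a)⟩
    -- Uses `(N + a)²(N - a) + (N - a)²(N + a) = 2N(N² - a²)`.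
    have h := hM.smul_mem (r := (2 * N)⁻¹) (by positivity)
      (hM.add_mem (hM.sq_mul_mem (algebraMap ℝ A N + a) h₁)
        (hM.sq_mul_mem (algebraMap ℝ A N - a) h₂))
    convert h using 1
    have h2 : (algebraMap ℝ A N + a) ^ 2 * (algebraMap ℝ A N - a) +
        (algebraMap ℝ A N - a) ^ 2 * (algebraMap ℝ A N + a) =
        (2 * N) • (algebraMap ℝ A (N ^ 2) - a ^ 2) := by
      rw [Algebra.smul_def, map_mul, map_ofNat, map_pow]
      ring
    rw [h2, smul_smul, inv_mul_cancel₀ (by positivity), one_smul]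
  have hadd : ∀ a b : A,
      (∃ N : ℝ, 0 < N ∧ algebraMap ℝ A N - a ∈ M ∧ algebraMap ℝ A N + a ∈ M) →
      (∃ N : ℝ, 0 < N ∧ algebraMap ℝ A N - b ∈ M ∧ algebraMap ℝ A N + b ∈ M) →
      ∃ N : ℝ, 0 < N ∧ algebraMap ℝ A N - (a + b) ∈ M ∧ algebraMap ℝ A N + (a + b) ∈ M := by
    rintro a b ⟨N, hN, h₁, h₂⟩ ⟨N', hN', h₁', h₂'⟩
    refine ⟨N + N', by positivity, ?_, ?_⟩
    · convert hM.add_mem h₁ h₁' using 1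
      rw [map_add]; ring
    · convert hM.add_mem h₂ h₂' using 1
      rw [map_add]; ring
  have hneg : ∀ a : A,
      (∃ N : ℝ, 0 < N ∧ algebraMap ℝ A N - a ∈ M ∧ algebraMap ℝ A N + a ∈ M) →
      ∃ N : ℝ, 0 < N ∧ algebraMap ℝ A N - -a ∈ M ∧ algebraMap ℝ A N + -a ∈ M := by
    rintro a ⟨N, hN, h₁, h₂⟩
    exact ⟨N, hN, by rwa [sub_neg_eq_add], by rwa [← sub_eq_add_neg]⟩
  have hconst : ∀ r : ℝ, ∃ N : ℝ, 0 < N ∧ algebraMap ℝ A N - algebraMap ℝ A r ∈ M ∧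
      algebraMap ℝ A N + algebraMap ℝ A r ∈ M := by
    intro r
    refine ⟨|r| + 1, by positivity, ?_, ?_⟩
    · rw [← map_sub]
      exact hM.algebraMap_mem (by linarith [le_abs_self r])
    · rw [← map_add]
      exact hM.algebraMap_mem (by linarith [neg_abs_le r])
  have hsmul : ∀ (r : ℝ) (a : A), 0 < r →
      (∃ N : ℝ, 0 < N ∧ algebraMap ℝ A N - a ∈ M ∧ algebraMap ℝ A N + a ∈ M) →
      ∃ N : ℝ, 0 < N ∧ algebraMap ℝ A N - r • a ∈ M ∧ algebraMap ℝ A N + r • a ∈ M := by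
    rintro r a hr ⟨N, hN, h₁, h₂⟩
    refine ⟨r * N, by positivity, ?_, ?_⟩
    · convert hM.smul_mem hr.le h₁ using 1
      rw [smul_sub, map_mul, Algebra.smul_def r (algebraMap ℝ A N)]
    · convert hM.smul_mem hr.le h₂ using 1
      rw [smul_add, map_mul, Algebra.smul_def r (algebraMap ℝ A N)]
  { carrier := {a | ∃ N : ℝ, 0 < N ∧ algebraMap ℝ A N - a ∈ M ∧ algebraMap ℝ A N + a ∈ M}
    algebraMap_mem' := hconst
    add_mem' := fun {a b} ha hb => hadd a b ha hb
    mul_mem' := fun {a b} ha hb => by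
      -- Polarization reduces products to squares: `4ab = (a + b)² - (a - b)²`.
      have h := hsmul (1 / 4) _ (by norm_num)
        (hadd _ _ (hsq _ (hadd _ _ ha hb)) (hneg _ (hsq _ (hadd _ _ ha (hneg _ hb)))))
      have h2 : (1 / 4 : ℝ) • ((a + b) ^ 2 + -(a + -b) ^ 2) = a * b := by
        have h3 : (a + b) ^ 2 + -(a + -b) ^ 2 = (4 : ℝ) • (a * b) := by
          rw [Algebra.smul_def, map_ofNat]
          ring
        rw [h3, smul_smul]
        norm_num
      rwa [h2] at h }

theorem mem_boundedSubalgebra (hM : IsQuadraticModule M) {a : A} :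
    a ∈ hM.boundedSubalgebra ↔
      ∃ N : ℝ, 0 < N ∧ algebraMap ℝ A N - a ∈ M ∧ algebraMap ℝ A N + a ∈ M :=
  Iff.rfl

end Basic

/-! ### States, extreme states and the representation theorem -/

section States

variable {A : Type*} [CommRing A] [Algebra ℝ A] {M : Set A}

/-- Cauchy–Schwarz inequality for functionals that are nonnegative on a quadratic module. -/
theorem map_mul_sq_le (hM : IsQuadraticModule M) {L : A →ₗ[ℝ] ℝ} (hL : ∀ m ∈ M, 0 ≤ L m)
    (a : A) {x : A} (hx : x ∈ M) : L (a * x) ^ 2 ≤ L x * L (a ^ 2 * x) := by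
  -- The quadratic `r ↦ L ((r + a)² x)` is nonnegative, so its discriminant is at most zero.
  have h := discrim_le_zero (a := L x) (b := 2 * L (a * x)) (c := L (a ^ 2 * x)) fun r => by
    have h1 := hL _ (hM.sq_mul_mem (algebraMap ℝ A r + a) hx)
    have h2 : (algebraMap ℝ A r + a) ^ 2 * x = (r * r) • x + (2 * r) • (a * x) + a ^ 2 * x := by
      simp only [Algebra.smul_def, map_mul, map_ofNat]
      ring
    rw [h2, map_add, map_add, map_smul, map_smul, smul_eq_mul, smul_eq_mul] at h1
    linarith
  rw [discrim] at h
  linarith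

/-- Each step of the induction uses that `(a ^ j)² (c - a²)` lies in the module. -/
theorem map_sq_pow_le (hM : IsQuadraticModule M) {L : A →ₗ[ℝ] ℝ} (hL : ∀ m ∈ M, 0 ≤ L m)
    (hL1 : L 1 = 1) {a : A} {c : ℝ} (hc : 0 ≤ c) (ha : algebraMap ℝ A c - a ^ 2 ∈ M) (j : ℕ) :
    L ((a ^ 2) ^ j) ≤ c ^ j := by
  induction j with
  | zero => simp [hL1]
  | succ j ih =>
    have h := hL _ (hM.sq_mul_mem (a ^ j) ha)
    have h2 : (a ^ j) ^ 2 * (algebraMap ℝ A c - a ^ 2) = c • (a ^ 2) ^ j - (a ^ 2) ^ (j + 1) := by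
      rw [Algebra.smul_def]
      ring
    rw [h2, map_sub, map_smul, smul_eq_mul] at h
    calc L ((a ^ 2) ^ (j + 1)) ≤ c * L ((a ^ 2) ^ j) := by linarith
      _ ≤ c * c ^ j := by gcongr
      _ = c ^ (j + 1) := by ring

/-- If `a ^ 2 ≤ c` modulo an archimedean quadratic module, then `L (a ^ 2 * x) ≤ c * L x` for
every state `L` and every `x` in the module. -/
theorem map_sq_mul_le (hM : IsQuadraticModule M)
    (harch : ∀ a : A, ∃ N : ℝ, algebraMap ℝ A N - a ∈ M)
    {L : A →ₗ[ℝ] ℝ} (hL : ∀ m ∈ M, 0 ≤ L m)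
    (hL1 : L 1 = 1) {a : A} {c : ℝ} (hc : 0 < c) (ha : algebraMap ℝ A c - a ^ 2 ∈ M)
    {x : A} (hx : x ∈ M) : L (a ^ 2 * x) ≤ c * L x := by
  obtain ⟨N, hN⟩ := harch x
  have hpow : ∀ j : ℕ, L ((a ^ 2) ^ j * x) ≤ |N| * c ^ j := fun j => by
    have h := hL _ (hM.sq_mul_mem (a ^ j) hN)
    have h2 : (a ^ j) ^ 2 * (algebraMap ℝ A N - x) = N • (a ^ 2) ^ j - (a ^ 2) ^ j * x := by
      rw [Algebra.smul_def]
      ring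
    rw [h2, map_sub, map_smul, smul_eq_mul] at h
    have h3 : 0 ≤ L ((a ^ 2) ^ j) := hL _ (by rw [← pow_mul, mul_comm, pow_mul]; exact hM.sq_mem _)
    calc L ((a ^ 2) ^ j * x) ≤ N * L ((a ^ 2) ^ j) := by linarith
      _ ≤ |N| * L ((a ^ 2) ^ j) := by gcongr; exact le_abs_self N
      _ ≤ |N| * c ^ j := by gcongr; exact hM.map_sq_pow_le hL hL1 hc.le ha j
  have h0 : 0 ≤ L x := hL x hx
  have hpos : ∀ j : ℕ, 0 ≤ L ((a ^ 2) ^ j * x) := fun j => hL _ (by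
    rw [← pow_mul, mul_comm 2 j, pow_mul]
    exact hM.sq_mul_mem _ hx)
  -- Cauchy–Schwarz iterated `m` times. Since `hpow` bounds the right side by a fixed constant times
  -- `(c * L x) ^ 2 ^ m`, taking `2 ^ m`-th roots would give the claim in the limit.
  have hcs : ∀ m : ℕ, L (a ^ 2 * x) ^ 2 ^ m * L x ≤ L x ^ 2 ^ m * L ((a ^ 2) ^ 2 ^ m * x) := by
    intro m
    induction m with
    | zero => simp [mul_comm]
    | succ m ih =>
      rcases h0.eq_or_lt with h | h
      · rw [← h]
        simp
      · have h1 := hM.map_mul_sq_le hL ((a ^ 2) ^ 2 ^ m) hx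
        rw [show ((a ^ 2) ^ 2 ^ m) ^ 2 = (a ^ 2) ^ 2 ^ (m + 1) by ring] at h1
        have h2 : (L (a ^ 2 * x) ^ 2 ^ m * L x) ^ 2 ≤
            (L x ^ 2 ^ m * L ((a ^ 2) ^ 2 ^ m * x)) ^ 2 := by
          have := hpos 1
          rw [pow_one] at this
          gcongr
        refine le_of_mul_le_mul_right ?_ h
        calc L (a ^ 2 * x) ^ 2 ^ (m + 1) * L x * L x
            = (L (a ^ 2 * x) ^ 2 ^ m * L x) ^ 2 := by ring
          _ ≤ (L x ^ 2 ^ m * L ((a ^ 2) ^ 2 ^ m * x)) ^ 2 := h2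
          _ = (L x ^ 2 ^ m) ^ 2 * L ((a ^ 2) ^ 2 ^ m * x) ^ 2 := by ring
          _ ≤ (L x ^ 2 ^ m) ^ 2 * (L x * L ((a ^ 2) ^ 2 ^ (m + 1) * x)) := by gcongr
          _ = L x ^ 2 ^ (m + 1) * L ((a ^ 2) ^ 2 ^ (m + 1) * x) * L x := by ring
  rcases h0.eq_or_lt with h | h
  · have h1 := hM.map_mul_sq_le hL (a ^ 2) hx
    rw [← h, zero_mul] at h1
    rw [← h, mul_zero]
    exact (pow_eq_zero_iff two_ne_zero).1 (le_antisymm h1 (sq_nonneg _)) |>.le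
  · by_contra! hlt
    -- If the claim failed, `t > 1` would have bounded powers `t ^ 2 ^ m`.
    set t : ℝ := L (a ^ 2 * x) / (c * L x) with ht
    have ht1 : 1 < t := (one_lt_div (by positivity)).2 hlt
    have hbd : ∀ m : ℕ, t ^ 2 ^ m ≤ |N| / L x := fun m => by
      rw [ht, div_pow, div_le_div_iff₀ (by positivity) h]
      calc L (a ^ 2 * x) ^ 2 ^ m * L x ≤ L x ^ 2 ^ m * L ((a ^ 2) ^ 2 ^ m * x) := hcs m
        _ ≤ L x ^ 2 ^ m * (|N| * c ^ 2 ^ m) := by gcongr; exact hpow _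
        _ = |N| * (c * L x) ^ 2 ^ m := by rw [mul_pow]; ring
    obtain ⟨m, hm⟩ := pow_unbounded_of_one_lt (|N| / L x) ht1
    have h3 : t ^ m ≤ t ^ 2 ^ m := pow_le_pow_right₀ ht1.le Nat.lt_two_pow_self.le
    linarith [hbd m]

/-- A state of an archimedean quadratic module that is not a proper convex combination of states
is multiplicative. -/
theorem map_mul_of_extreme (hM : IsQuadraticModule M)
    (harch : ∀ a : A, ∃ N : ℝ, algebraMap ℝ A N - a ∈ M)
    {L : A →ₗ[ℝ] ℝ} (hL : ∀ m ∈ M, 0 ≤ L m) (hL1 : L 1 = 1)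
    (hext : ∀ L₁ L₂ : A →ₗ[ℝ] ℝ, (∀ m ∈ M, 0 ≤ L₁ m) → L₁ 1 = 1 → (∀ m ∈ M, 0 ≤ L₂ m) →
      L₂ 1 = 1 → ∀ t : ℝ, 0 < t → t < 1 → L = t • L₁ + (1 - t) • L₂ → L₁ = L)
    (a b : A) : L (a * b) = L a * L b := by
  -- When `a² ≤ 1/2`, both `L (a² ·)` and `L - L (a² ·)` are nonnegative on the module. After
  -- normalization they write `L` as a convex combination with weight `t = L (a²) < 1`, and
  -- extremality identifies the first with `L`.
  have hsmall : ∀ (a b : A), algebraMap ℝ A (1 / 2) - a ^ 2 ∈ M → L (a ^ 2 * b) = L (a ^ 2) * L b := by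
    intro a b ha
    set L₁ : A →ₗ[ℝ] ℝ := L ∘ₗ LinearMap.mulLeft ℝ (a ^ 2) with hL₁
    have hL₁a : ∀ x, L₁ x = L (a ^ 2 * x) := fun x => rfl
    have hpos₁ : ∀ m ∈ M, 0 ≤ L₁ m := fun m hm => hL _ (hM.sq_mul_mem a hm)
    have hle : ∀ m ∈ M, L₁ m ≤ 1 / 2 * L m := fun m hm =>
      hM.map_sq_mul_le harch hL hL1 (by norm_num) ha hm
    have h11 : L₁ 1 = L (a ^ 2) := by rw [hL₁a, mul_one]
    have ht0 : 0 ≤ L (a ^ 2) := hL _ (hM.sq_mem a)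
    have ht2 : L (a ^ 2) ≤ 1 / 2 := by
      have := hle 1 hM.one_mem
      rwa [h11, hL1, mul_one] at this
    rcases ht0.eq_or_lt with h | h
    -- A functional nonnegative on `M` and zero at `1` vanishes, by archimedeanness.
    · have hupper : ∀ x : A, L₁ x ≤ 0 := fun x => by
        obtain ⟨N, hN⟩ := harch x
        have := hpos₁ _ hN
        rw [map_sub, Algebra.algebraMap_eq_smul_one, map_smul, h11, ← h, smul_zero] at this
        linarith
      have h1 := hupper b
      have h2 := hupper (-b)
      rw [map_neg] at h2
      rw [← hL₁a, ← h, zero_mul]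
      linarith
    · set t := L (a ^ 2) with ht
      have h1t : 0 < 1 - t := by linarith
      have key := hext (t⁻¹ • L₁) ((1 - t)⁻¹ • (L - L₁))
        (fun m hm => by
          have := hpos₁ m hm
          rw [LinearMap.smul_apply, smul_eq_mul]
          positivity)
        (by rw [LinearMap.smul_apply, h11, smul_eq_mul, inv_mul_cancel₀ h.ne'])
        (fun m hm => by
          have h1 := hle m hm
          have h2 := hL m hm
          rw [LinearMap.smul_apply, smul_eq_mul, LinearMap.sub_apply]
          exact mul_nonneg (inv_nonneg.2 h1t.le) (by linarith))
        (by rw [LinearMap.smul_apply, LinearMap.sub_apply, h11, hL1, smul_eq_mul,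
              inv_mul_cancel₀ h1t.ne'])
        t h (by linarith)
        (by rw [smul_smul, smul_smul, mul_inv_cancel₀ h.ne', mul_inv_cancel₀ h1t.ne', one_smul,
              one_smul, add_sub_cancel])
      have hb := LinearMap.congr_fun key b
      rw [LinearMap.smul_apply, smul_eq_mul, hL₁a, inv_mul_eq_iff_eq_mul₀ h.ne'] at hb
      exact hb
  have hsq : ∀ a b : A, L (a ^ 2 * b) = L (a ^ 2) * L b := by
    intro a b
    obtain ⟨N, hN⟩ := harch (a ^ 2)
    -- Scaling by `r` brings `a²` below `1/2`, so that `hsmall` applies.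
    set r : ℝ := Real.sqrt (2 * (|N| + 1))⁻¹ with hr
    have hr2 : r ^ 2 = (2 * (|N| + 1))⁻¹ := Real.sq_sqrt (by positivity)
    have hr0 : r ^ 2 ≠ 0 := by rw [hr2]; positivity
    have h1 : (r • a) ^ 2 = r ^ 2 • a ^ 2 := smul_pow r a 2
    have h2 : algebraMap ℝ A (1 / 2) - (r • a) ^ 2 ∈ M := by
      have h3 := hM.add_mem (hM.smul_mem (sq_nonneg r) hN)
        (hM.algebraMap_mem (r := 1 / 2 - r ^ 2 * N) (by
          have : r ^ 2 * N ≤ r ^ 2 * (|N| + 1) := by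
            gcongr
            linarith [le_abs_self N]
          have h4 : r ^ 2 * (|N| + 1) = 1 / 2 := by
            rw [hr2]
            field_simp
          linarith))
      convert h3 using 1
      rw [h1, smul_sub, Algebra.smul_def (r ^ 2) (algebraMap ℝ A N), ← map_mul, map_sub]
      ring
    have h3 := hsmall (r • a) b h2
    rw [h1, smul_mul_assoc, map_smul, map_smul, smul_eq_mul, smul_eq_mul, mul_assoc] at h3
    exact mul_left_cancel₀ hr0 h3
  -- Polarization: `4a = (a + 1)² - (a - 1)²`.
  have h1 := hsq (a + 1) b
  have h2 := hsq (a - 1) b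
  have h3 : (a + 1) ^ 2 * b = (a - 1) ^ 2 * b + (4 : ℝ) • (a * b) := by
    rw [Algebra.smul_def, map_ofNat]
    ring
  have h4 : (a + 1) ^ 2 = (a - 1) ^ 2 + (4 : ℝ) • a := by
    rw [Algebra.smul_def, map_ofNat]
    ring
  rw [h3, h4, map_add, map_add, map_smul, map_smul, smul_eq_mul, smul_eq_mul, h2] at h1
  linarith

/-- An element outside an archimedean quadratic module is nonpositive at some state. -/
theorem exists_state_nonpos (hM : IsQuadraticModule M)
    (harch : ∀ a : A, ∃ N : ℝ, algebraMap ℝ A N - a ∈ M) {p : A} (hp : p ∉ M) :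
    ∃ L : A →ₗ[ℝ] ℝ, (∀ m ∈ M, 0 ≤ L m) ∧ L 1 = 1 ∧ L p ≤ 0 := by
  -- The cone `M - ℝ≥0 p`; a functional nonnegative on it is nonnegative on `M` and nonpositive at
  -- `p`.
  let s : PointedCone ℝ A :=
    { carrier := {a | ∃ m ∈ M, ∃ t : ℝ, 0 ≤ t ∧ a = m - t • p}
      add_mem' := by
        rintro _ _ ⟨m, hm, t, ht, rfl⟩ ⟨m', hm', t', ht', rfl⟩
        exact ⟨m + m', hM.add_mem hm hm', t + t', add_nonneg ht ht', by rw [add_smul]; abel⟩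
      zero_mem' := ⟨0, hM.zero_mem, 0, le_rfl, by simp⟩
      smul_mem' := by
        rintro ⟨c, hc⟩ _ ⟨m, hm, t, ht, rfl⟩
        refine ⟨c • m, hM.smul_mem hc hm, c * t, mul_nonneg hc ht, ?_⟩
        rw [Nonneg.mk_smul, smul_sub, smul_smul] }
  -- A negative constant in `s` would put `p` in `M`: directly if `t > 0`, and if `t = 0` because
  -- then `M` contains a negative constant, which absorbs the bound `N` in `N + p ∈ M`.
  have hneg : ∀ r : ℝ, r • (1 : A) ∈ s → 0 ≤ r := by
    rintro r ⟨m, hm, t, ht, heq⟩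
    by_contra! hr
    have htp : t • p = m + (-r) • (1 : A) := by
      rw [neg_smul, heq]; abel
    rcases ht.eq_or_lt with h0 | h0
    · obtain ⟨N, hN⟩ := harch (-p)
      rw [← h0, zero_smul] at htp
      have h1 : (|N| / (-r)) • (m + (-r) • (1 : A)) = 0 := by rw [← htp, smul_zero]
      refine hp ?_
      have h2 := hM.add_mem (hM.add_mem hN (hM.smul_mem (r := |N| / (-r))
        (div_nonneg (abs_nonneg N) (by linarith)) hm))
        (hM.algebraMap_mem (r := |N| - N) (by linarith [le_abs_self N]))
      convert h2 using 1
      have h3 : (|N| / (-r)) • m = - algebraMap ℝ A |N| := by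
        rw [smul_add, smul_smul, div_mul_cancel₀ _ (by linarith)] at h1
        rw [Algebra.algebraMap_eq_smul_one]
        exact eq_neg_of_add_eq_zero_left h1
      rw [h3, map_sub]
      ring
    · refine hp ?_
      have h2 : p = t⁻¹ • (m + (-r) • (1 : A)) := by
        rw [← htp, smul_smul, inv_mul_cancel₀ h0.ne', one_smul]
      rw [h2]
      exact hM.smul_mem (inv_nonneg.2 h0.le)
        (hM.add_mem hm (hM.smul_mem (by linarith) hM.one_mem))
  have h10 : (1 : A) ≠ 0 := fun h => by
    have := hneg (-1) (by rw [h, smul_zero]; exact s.zero_mem)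
    linarith
  obtain ⟨L, hLf, hL⟩ := riesz_extension s 
    (LinearPMap.mkSpanSingleton' (1 : A) (1 : ℝ)
      fun c hc => by rw [(smul_eq_zero.1 hc).resolve_right h10, map_zero, zero_smul])
    (by
      rintro ⟨x, hx⟩ hxs
      obtain ⟨r, rfl⟩ := Submodule.mem_span_singleton.1 hx
      rw [LinearPMap.mkSpanSingleton'_apply]
      simpa using hneg r hxs)
    (fun y => by
      obtain ⟨N, hN⟩ := harch (-y)
      refine ⟨⟨N • 1, Submodule.mem_span_singleton.2 ⟨N, rfl⟩⟩, _, hN, 0, le_rfl, ?_⟩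
      simp [Algebra.algebraMap_eq_smul_one])
  refine ⟨L, fun m hm => hL m ⟨m, hm, 0, le_rfl, by simp⟩, ?_, ?_⟩
  · exact (hLf ⟨1, Submodule.mem_span_singleton_self 1⟩).trans
      (LinearPMap.mkSpanSingleton'_apply_self _ _ _ _)
  · have := hL (-p) ⟨0, hM.zero_mem, 1, zero_le_one, by simp⟩
    rw [map_neg] at this
    linarith

/-- The states of `M`, as a set of functions on `A`. -/
def stateSet (M : Set A) : Set (A → ℝ) :=
  {F | ∃ L : A →ₗ[ℝ] ℝ, (∀ m ∈ M, 0 ≤ L m) ∧ L 1 = 1 ∧ ⇑L = F}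

/-- Tychonoff: the archimedean bounds for `a` and `-a` confine states to a product of intervals, and
being a state is a pointwise closed condition. -/
theorem isCompact_stateSet (harch : ∀ a : A, ∃ N : ℝ, algebraMap ℝ A N - a ∈ M) :
    IsCompact (stateSet M) := by
  choose N hN using harch
  have hsub : stateSet M ⊆ Set.univ.pi fun a => Set.Icc (-N (-a)) (N a) := by
    rintro _ ⟨L, hL, hL1, rfl⟩ a -
    have h1 := hL _ (hN a)
    have h2 := hL _ (hN (-a))
    rw [map_sub, Algebra.algebraMap_eq_smul_one, map_smul, hL1, smul_eq_mul, mul_one] at h1 h2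
    rw [map_neg] at h2
    exact ⟨by linarith, by linarith⟩
  refine (isCompact_univ_pi fun a => isCompact_Icc).of_isClosed_subset ?_ hsub
  have heq : stateSet M = {F : A → ℝ | (∀ a b, F (a + b) = F a + F b) ∧
      (∀ (r : ℝ) a, F (r • a) = r * F a) ∧ (∀ m ∈ M, 0 ≤ F m) ∧ F 1 = 1} := by
    ext F
    constructor
    · rintro ⟨L, hL, hL1, rfl⟩
      exact ⟨map_add L, map_smul L, hL, hL1⟩
    · rintro ⟨h1, h2, h3, h4⟩
      exact ⟨{ toFun := F, map_add' := h1, map_smul' := h2 }, h3, h4, rfl⟩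
  rw [heq]
  refine IsClosed.and ?_ (IsClosed.and ?_ (IsClosed.and ?_ ?_))
  · simp only [Set.ofPred_forall]
    exact isClosed_iInter fun a => isClosed_iInter fun b =>
      isClosed_eq (continuous_apply _) ((continuous_apply a).add (continuous_apply b))
  · simp only [Set.ofPred_forall]
    exact isClosed_iInter fun a => isClosed_iInter fun b =>
      isClosed_eq (continuous_apply _) (continuous_const.mul (continuous_apply _))
  · simp only [Set.ofPred_forall]
    exact isClosed_iInter fun a => isClosed_iInter fun b =>
      isClosed_le continuous_const (continuous_apply _)
  · exact isClosed_eq (continuous_apply _) continuous_const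

/-- **Representation theorem** for archimedean quadratic modules: an element which is positive at
every character that is nonnegative on the module belongs to the module. -/
theorem mem_of_forall_algHom_pos (hM : IsQuadraticModule M)
    (harch : ∀ a : A, ∃ N : ℝ, algebraMap ℝ A N - a ∈ M) {p : A}
    (hp : ∀ φ : A →ₐ[ℝ] ℝ, (∀ m ∈ M, 0 ≤ φ m) → 0 < φ p) : p ∈ M := by
  by_contra hpM
  obtain ⟨L₀, hL₀, hL₀1, hL₀p⟩ := hM.exists_state_nonpos harch hpM
  have hcpt := isCompact_stateSet harch
  obtain ⟨F, hFS, hFmin⟩ := hcpt.exists_isMinOn ⟨_, L₀, hL₀, hL₀1, rfl⟩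
    (continuous_apply p).continuousOn
  have hFp : F p ≤ 0 := (hFmin ⟨L₀, hL₀, hL₀1, rfl⟩ : F p ≤ L₀ p).trans hL₀p
  -- The states minimizing `p` form a compact face; an extreme point of this face is extreme among
  -- all states, since both parts of a decomposition must also attain the minimum.
  have hT : IsCompact (stateSet M ∩ {G | G p = F p}) :=
    hcpt.inter_right (isClosed_eq (continuous_apply p) continuous_const)
  obtain ⟨G, ⟨⟨L, hL, hL1, rfl⟩, hLp⟩, hGext⟩ := hT.extremePoints_nonempty ⟨F, hFS, rfl⟩
  have hmul := hM.map_mul_of_extreme harch hL hL1 (by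
    intro L₁ L₂ h₁ h₁' h₂ h₂' t ht0 ht1 heq
    have e1 : F p ≤ L₁ p := hFmin ⟨L₁, h₁, h₁', rfl⟩
    have e2 : F p ≤ L₂ p := hFmin ⟨L₂, h₂, h₂', rfl⟩
    have e3 : L p = t * L₁ p + (1 - t) * L₂ p := by rw [heq]; simp
    have e4 : L p = F p := hLp
    have k1 : 0 ≤ t * (L₁ p - F p) := mul_nonneg ht0.le (by linarith)
    have k2 : 0 ≤ (1 - t) * (L₂ p - F p) := mul_nonneg (by linarith) (by linarith)
    have f1 : t * (L₁ p - F p) = 0 := by linarith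
    have f2 : (1 - t) * (L₂ p - F p) = 0 := by linarith
    have g1 : L₁ p = F p := by
      rcases mul_eq_zero.1 f1 with h | h <;> linarith
    have g2 : L₂ p = F p := by
      rcases mul_eq_zero.1 f2 with h | h <;> linarith
    refine DFunLike.coe_injective (hGext ⟨⟨L₁, h₁, h₁', rfl⟩, g1⟩ ⟨⟨L₂, h₂, h₂', rfl⟩, g2⟩
      ⟨t, 1 - t, ht0, by linarith, by ring, ?_⟩)
    rw [heq]
    rfl)
  have hpos := hp (AlgHom.ofLinearMap L hL1 hmul) hL
  have hLp' : L p = F p := hLp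
  rw [AlgHom.ofLinearMap_apply] at hpos
  linarith

end States

end IsQuadraticModule

end MomentCone

namespace MomentCone

open MvPolynomial MeasureTheory

/-! ### Putinar's theorem for `I(h) + Q(g)` -/

section Putinar

variable {n m₁ m₂ : ℕ} (h : Fin m₁ → MvPolynomial (Fin n) ℝ) (g : Fin m₂ → MvPolynomial (Fin n) ℝ)

/-- The quadratic module `I(h) + Q(g)`. -/
def idealAddQuadModule : Set (MvPolynomial (Fin n) ℝ) :=
  {p | ∃ a ∈ idealGen h, ∃ q ∈ quadModule g, p = a + q}

theorem isQuadraticModule_idealAddQuadModule : IsQuadraticModule (idealAddQuadModule h g) where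
  one_mem := ⟨0, zero_mem _, 1, ⟨1, 0, IsSumSq.one, fun _ => IsSumSq.zero, by simp⟩, by simp⟩
  add_mem := by
    rintro _ _ ⟨a, ha, _, ⟨σ₀, σ, hσ₀, hσ, rfl⟩, rfl⟩ ⟨a', ha', _, ⟨τ₀, τ, hτ₀, hτ, rfl⟩, rfl⟩
    refine ⟨a + a', add_mem ha ha', _, ⟨σ₀ + τ₀, σ + τ, hσ₀.add hτ₀,
      fun j => (hσ j).add (hτ j), rfl⟩, ?_⟩
    simp only [Pi.add_apply, mul_add, Finset.sum_add_distrib]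
    ring
  sq_mul_mem := by
    rintro b _ ⟨a, ha, _, ⟨σ₀, σ, hσ₀, hσ, rfl⟩, rfl⟩
    have hb : IsSumSq (b ^ 2) := by
      rw [sq]
      exact IsSumSq.mul_self b
    refine ⟨b ^ 2 * a, Ideal.mul_mem_left _ _ ha, _, ⟨b ^ 2 * σ₀, fun j => b ^ 2 * σ j,
      hb.mul hσ₀, fun j => hb.mul (hσ j), rfl⟩, ?_⟩
    rw [mul_add, mul_add, Finset.mul_sum]
    congr 2
    exact Finset.sum_congr rfl fun j _ => by ring

variable {h g}

/-- The bounded elements form a subalgebra, so it suffices to bound the variables. -/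
theorem IsArchimedean.exists_sub_mem (harch : IsArchimedean h g) (a : MvPolynomial (Fin n) ℝ) :
    ∃ N : ℝ, algebraMap ℝ _ N - a ∈ idealAddQuadModule h g := by
  have hM := isQuadraticModule_idealAddQuadModule h g
  obtain ⟨R, hR, hmem⟩ := harch
  have hX : ∀ i, (X i : MvPolynomial (Fin n) ℝ) ∈ hM.boundedSubalgebra := fun i => by
    have h1 : ∀ s : Finset (Fin n), (∑ j ∈ s, X j ^ 2 : MvPolynomial (Fin n) ℝ) ∈
        idealAddQuadModule h g := fun s => by
      classical
      induction s using Finset.induction_on with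
      | empty => simpa using hM.zero_mem
      | insert j s hj ih =>
        rw [Finset.sum_insert hj]
        exact hM.add_mem (hM.sq_mem _) ih
    have h2 : (C R - X i ^ 2 : MvPolynomial (Fin n) ℝ) ∈ idealAddQuadModule h g := by
      have h3 := hM.add_mem (show _ ∈ idealAddQuadModule h g from hmem) (h1 (Finset.univ.erase i))
      rw [← Finset.add_sum_erase Finset.univ _ (Finset.mem_univ i)] at h3
      convert h3 using 1
      ring
    -- Completing the square: `R + 1/4 ∓ X i = (R - X i ^ 2) + (X i ∓ 1/2) ^ 2`.
    refine ⟨R + 1 / 4, by positivity, ?_, ?_⟩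
    · convert hM.add_mem h2 (hM.sq_mem (X i - C (1 / 2))) using 1
      have h4 : (C (1 / 2) : MvPolynomial (Fin n) ℝ) * C (1 / 2) = C (1 / 4) := by
        rw [← C_mul]; norm_num
      have h5 : (C (1 / 2) : MvPolynomial (Fin n) ℝ) + C (1 / 2) = 1 := by
        rw [← C_add]; norm_num
      rw [algebraMap_eq, C_add, ← h4]
      linear_combination X i * h5
    · convert hM.add_mem h2 (hM.sq_mem (X i + C (1 / 2))) using 1
      have h4 : (C (1 / 2) : MvPolynomial (Fin n) ℝ) * C (1 / 2) = C (1 / 4) := by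
        rw [← C_mul]; norm_num
      have h5 : (C (1 / 2) : MvPolynomial (Fin n) ℝ) + C (1 / 2) = 1 := by
        rw [← C_add]; norm_num
      rw [algebraMap_eq, C_add, ← h4]
      linear_combination - X i * h5
  have ha : a ∈ hM.boundedSubalgebra := by
    induction a using MvPolynomial.induction_on with
    | C r => exact hM.boundedSubalgebra.algebraMap_mem r
    | add p q hp hq => exact add_mem hp hq
    | mul_X p i hp => exact mul_mem hp (hX i)
  obtain ⟨N, -, hN, -⟩ := hM.mem_boundedSubalgebra.1 ha
  exact ⟨N, hN⟩

theorem eval_nonneg_of_isSumSq {x : Fin n → ℝ} {σ : MvPolynomial (Fin n) ℝ} (hσ : IsSumSq σ) :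
    0 ≤ eval x σ := by
  induction hσ with
  | zero => simp
  | sq_add a _ ih =>
    rw [map_add, map_mul]
    exact add_nonneg (mul_self_nonneg _) ih

theorem eval_nonneg_of_mem {p : MvPolynomial (Fin n) ℝ} (hp : p ∈ idealAddQuadModule h g)
    {x : Fin n → ℝ} (hx : x ∈ semialgSet h g) : 0 ≤ eval x p := by
  obtain ⟨a, ha, _, ⟨σ₀, σ, hσ₀, hσ, rfl⟩, rfl⟩ := hp
  have ha0 : eval x a = 0 := by
    have hle : idealGen h ≤ RingHom.ker (eval x) := Ideal.span_le.2 (by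
      rintro _ ⟨i, rfl⟩
      exact hx.1 i)
    exact hle ha
  rw [map_add, map_add, ha0, zero_add, map_sum]
  refine add_nonneg (eval_nonneg_of_isSumSq hσ₀) (Finset.sum_nonneg fun j _ => ?_)
  rw [map_mul]
  exact mul_nonneg (hx.2 j) (eval_nonneg_of_isSumSq (hσ j))

/-- **Putinar's Positivstellensatz**. -/
theorem IsArchimedean.mem_of_forall_eval_pos (harch : IsArchimedean h g)
    {p : MvPolynomial (Fin n) ℝ} (hp : ∀ x ∈ semialgSet h g, 0 < eval x p) :
    p ∈ idealAddQuadModule h g := by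
  have hM := isQuadraticModule_idealAddQuadModule h g
  refine hM.mem_of_forall_algHom_pos harch.exists_sub_mem fun φ hφ => ?_
  -- Characters of the polynomial ring are point evaluations; nonnegativity on the module, tested on
  -- `±h i` and `g j`, places the point in `K`.
  have hev : ∀ q, φ q = eval (fun i => φ (X i)) q := fun q => by
    have : φ = aeval fun i => φ (X i) := algHom_ext (by simp)
    rw [← aeval_eq_eval]
    exact DFunLike.congr_fun this q
  rw [hev]
  refine hp _ ⟨fun i => ?_, fun j => ?_⟩
  · have hi : h i ∈ idealGen h := Ideal.subset_span ⟨i, rfl⟩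
    have hQ : (0 : MvPolynomial (Fin n) ℝ) ∈ quadModule g :=
      ⟨0, 0, IsSumSq.zero, fun _ => IsSumSq.zero, by simp⟩
    have h1 := hφ (h i) ⟨_, hi, 0, hQ, by simp⟩
    have h2 := hφ (-h i) ⟨_, neg_mem hi, 0, hQ, by simp⟩
    rw [map_neg] at h2
    rw [← hev]
    linarith
  · rw [← hev]
    classical
    refine hφ (g j) ⟨0, zero_mem _, _, ⟨0, Pi.single j 1, IsSumSq.zero, fun i => ?_, rfl⟩, ?_⟩
    · rcases eq_or_ne i j with rfl | hij
      · rw [Pi.single_eq_same]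
        exact IsSumSq.one
      · rw [Pi.single_eq_of_ne hij]
        exact IsSumSq.zero
    · simp [Pi.single_apply]

theorem IsArchimedean.isCompact_semialgSet (harch : IsArchimedean h g) :
    IsCompact (semialgSet h g) := by
  obtain ⟨R, hR, hmem⟩ := harch
  refine Metric.isCompact_of_isClosed_isBounded ?_ ?_
  · refine IsClosed.and ?_ ?_
    · simp only [Set.ofPred_forall]
      exact isClosed_iInter fun i => isClosed_eq (continuous_eval (h i)) continuous_const
    · simp only [Set.ofPred_forall]
      exact isClosed_iInter fun j => isClosed_le continuous_const (continuous_eval (g j))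
  · refine isBounded_iff_forall_norm_le.2 ⟨Real.sqrt R, fun x hx => ?_⟩
    have h1 := eval_nonneg_of_mem (show _ ∈ idealAddQuadModule h g from hmem) hx
    simp only [map_sub, eval_C, map_sum, map_pow, eval_X] at h1
    refine (pi_norm_le_iff_of_nonneg (Real.sqrt_nonneg R)).2 fun i => ?_
    rw [Real.norm_eq_abs]
    refine Real.abs_le_sqrt ?_
    have h2 : x i ^ 2 ≤ ∑ i, x i ^ 2 :=
      Finset.single_le_sum (f := fun i => x i ^ 2) (fun i _ => sq_nonneg (x i))
      (Finset.mem_univ i)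
    linarith

end Putinar

/-! ### The pairing between polynomials and truncated moment sequences -/

section Riesz

variable {n : ℕ} {A : Finset (Fin n →₀ ℕ)}

theorem riesz_add_left (p q : MvPolynomial (Fin n) ℝ) (y : Tms A) :
    riesz (p + q) y = riesz p y + riesz q y := by
  simp [riesz, add_mul, Finset.sum_add_distrib]

theorem riesz_smul_left (r : ℝ) (p : MvPolynomial (Fin n) ℝ) (y : Tms A) :
    riesz (r • p) y = r * riesz p y := by
  simp [riesz, mul_assoc, Finset.mul_sum]

/-- The pairing with a fixed truncated moment sequence, as a linear functional. -/
noncomputable def rieszLeft (y : Tms A) : MvPolynomial (Fin n) ℝ →ₗ[ℝ] ℝ where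
  toFun p := riesz p y
  map_add' p q := riesz_add_left p q y
  map_smul' r p := riesz_smul_left r p y

theorem riesz_sum_left {ι : Type*} (s : Finset ι) (p : ι → MvPolynomial (Fin n) ℝ) (y : Tms A) :
    riesz (∑ i ∈ s, p i) y = ∑ i ∈ s, riesz (p i) y :=
  map_sum (rieszLeft y) p s

/-- The pairing with a fixed polynomial, as a continuous linear functional. -/
noncomputable def rieszRight (p : MvPolynomial (Fin n) ℝ) : StrongDual ℝ (Tms A) :=
  LinearMap.toContinuousLinearMap
    { toFun := fun y => riesz p y
      map_add' := fun y y' => by simp [riesz, mul_add, Finset.sum_add_distrib]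
      map_smul' := fun r y => by simp [riesz, Finset.mul_sum, mul_left_comm] }

theorem eq_sum_coeff_smul_monomial {p : MvPolynomial (Fin n) ℝ} (hp : p.support ⊆ A) :
    p = ∑ α : A, coeff (α : Fin n →₀ ℕ) p • monomial (α : Fin n →₀ ℕ) (1 : ℝ) := by
  rw [Finset.sum_coe_sort A fun α => coeff α p • monomial α (1 : ℝ)]
  conv_lhs => rw [p.as_sum]
  rw [Finset.sum_subset hp]
  · exact Finset.sum_congr rfl fun α _ => by rw [smul_monomial, smul_eq_mul, mul_one]
  · intro α _ hα
    rw [notMem_support_iff.1 hα, map_zero]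

theorem support_subset_of_mem_polySpan {p : MvPolynomial (Fin n) ℝ} (hp : p ∈ polySpan A) :
    p.support ⊆ A := by
  classical
  induction hp using Submodule.span_induction with
  | mem p hp =>
    obtain ⟨α, hα, rfl⟩ := hp
    exact support_monomial_subset.trans (Finset.singleton_subset_iff.2 hα)
  | zero => simp
  | add p q _ _ hp hq => exact support_add.trans (Finset.union_subset hp hq)
  | smul r p _ hp => exact support_smul.trans hp

theorem exists_riesz_eq (l : StrongDual ℝ (Tms A)) :
    ∃ p : MvPolynomial (Fin n) ℝ, p.support ⊆ A ∧ ∀ y : Tms A, riesz p y = l y := by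
  classical
  refine ⟨∑ α : A, monomial (α : Fin n →₀ ℕ) (l (EuclideanSpace.single α 1)), ?_, fun y => ?_⟩
  · refine (support_sum).trans (Finset.biUnion_subset.2 fun α _ => ?_)
    exact support_monomial_subset.trans (Finset.singleton_subset_iff.2 α.2)
  · have hc : ∀ β : A, coeff (β : Fin n →₀ ℕ)
        (∑ α : A, monomial (α : Fin n →₀ ℕ) (l (EuclideanSpace.single α 1))) =
        l (EuclideanSpace.single β 1) := fun β => by
      rw [coeff_sum, Finset.sum_eq_single β]
      · simp
      · intro α _ hα
        rw [coeff_monomial, if_neg fun h => hα (Subtype.ext h)]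
      · simp
    have hy : y = ∑ α : A, y α • EuclideanSpace.single α (1 : ℝ) := by
      ext β
      simp [Pi.single_apply]
    simp only [riesz, hc]
    conv_rhs => rw [hy]
    rw [map_sum]
    exact Finset.sum_congr rfl fun α _ => by rw [map_smul, smul_eq_mul, mul_comm]

theorem riesz_restrict {B : Finset (Fin n →₀ ℕ)} (hAB : A ⊆ B) {p : MvPolynomial (Fin n) ℝ}
    (hp : p.support ⊆ A) (z : Tms B) : riesz p (restrict hAB z) = riesz p z := by
  have h1 : ∀ (D : Finset (Fin n →₀ ℕ)) (w : Tms D), riesz p w =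
      ∑ α ∈ D, coeff α p * (if hα : α ∈ D then w ⟨α, hα⟩ else 0) := fun D w => by
    rw [riesz, ← Finset.sum_coe_sort D]
    exact Finset.sum_congr rfl fun α _ => by rw [dif_pos α.2]
  rw [h1, h1]
  rw [← Finset.sum_subset hAB]
  · refine Finset.sum_congr rfl fun α hα => ?_
    rw [dif_pos hα, dif_pos (hAB hα)]
    rfl
  · intro α _ hα
    rw [notMem_support_iff.1 fun h => hα (hp h), zero_mul]

end Riesz

/-! ### Positivity certificates seen by the relaxations -/

section Relaxation

variable {n m₁ m₂ : ℕ} {h : Fin m₁ → MvPolynomial (Fin n) ℝ} {g : Fin m₂ → MvPolynomial (Fin n) ℝ}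

theorem mem_expUpTo {d : ℕ} {α : Fin n →₀ ℕ} : α ∈ expUpTo n d ↔ α.degree ≤ d := by
  simp [expUpTo]

/-- The degree condition is stronger than necessary, which is harmless because only large `k`
matters. -/
theorem support_subset_locIndex {p q : MvPolynomial (Fin n) ℝ} {k : ℕ}
    (hk : q.totalDegree + p.totalDegree ≤ k) : p.support ⊆ locIndex q k := by
  intro α hα
  have h1 : α.degree ≤ p.totalDegree := le_totalDegree hα
  simp only [locIndex, Finset.mem_filter, mem_expUpTo]
  omega

/-- The pairing is the quadratic form of the localizing matrix at the coefficient vector of `p`. -/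
theorem riesz_mul_sq_nonneg {p q : MvPolynomial (Fin n) ℝ} {k : ℕ}
    (hk : q.totalDegree + p.totalDegree ≤ k) {z : Tms (expUpTo n (2 * k))}
    (hz : (locMatrix q k z).PosSemidef) : 0 ≤ riesz (q * (p * p)) z := by
  have h1 := hz.dotProduct_mulVec_nonneg fun α => coeff (α : Fin n →₀ ℕ) p
  have h2 : q * (p * p) = ∑ α : locIndex q k, ∑ β : locIndex q k,
      (coeff (α : Fin n →₀ ℕ) p * coeff (β : Fin n →₀ ℕ) p) •
        (q * monomial ((α : Fin n →₀ ℕ) + (β : Fin n →₀ ℕ)) (1 : ℝ)) := by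
    conv_lhs => rw [eq_sum_coeff_smul_monomial (support_subset_locIndex hk)]
    rw [Finset.sum_mul_sum, Finset.mul_sum]
    refine Finset.sum_congr rfl fun α _ => ?_
    rw [Finset.mul_sum]
    refine Finset.sum_congr rfl fun β _ => ?_
    rw [smul_mul_smul_comm, monomial_mul, one_mul, mul_smul_comm]
  rw [h2, riesz_sum_left]
  refine h1.trans_eq ?_
  simp only [dotProduct, Matrix.mulVec]
  refine Finset.sum_congr rfl fun α _ => ?_
  rw [riesz_sum_left, Finset.mul_sum]
  refine Finset.sum_congr rfl fun β _ => ?_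
  rw [riesz_smul_left]
  simp only [locMatrix, Matrix.of_apply, Pi.star_apply, star_trivial]
  ring

theorem riesz_mul_eq_zero {p q : MvPolynomial (Fin n) ℝ} {k : ℕ}
    (hk : q.totalDegree + p.totalDegree ≤ k) {z : Tms (expUpTo n (2 * k))}
    (hz : locMatrix q k z = 0) : riesz (q * p) z = 0 := by
  -- The column of index `0` contains the pairings with `q x^α` themselves.
  have h0 : (0 : Fin n →₀ ℕ) ∈ locIndex q k := by
    simp only [locIndex, Finset.mem_filter, mem_expUpTo, map_zero]
    omega
  rw [eq_sum_coeff_smul_monomial (support_subset_locIndex hk), Finset.mul_sum, riesz_sum_left]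
  refine Finset.sum_eq_zero fun α _ => ?_
  have h1 := congrFun (congrFun hz α) ⟨0, h0⟩
  simp only [locMatrix, Matrix.of_apply, add_zero, Matrix.zero_apply] at h1
  rw [mul_smul_comm, riesz_smul_left, h1, mul_zero]

theorem eventually_riesz_mul_nonneg {q σ : MvPolynomial (Fin n) ℝ} (hσ : IsSumSq σ) :
    ∀ᶠ k in Filter.atTop, ∀ z : Tms (expUpTo n (2 * k)), (locMatrix q k z).PosSemidef →
      0 ≤ riesz (q * σ) z := by
  induction hσ with
  | zero => exact Filter.Eventually.of_forall fun k z _ => by simp [riesz]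
  | sq_add a _ ih =>
    filter_upwards [ih, Filter.eventually_ge_atTop (q.totalDegree + a.totalDegree)]
      with k h1 h2 z hz
    rw [mul_add, riesz_add_left]
    exact add_nonneg (riesz_mul_sq_nonneg h2 hz) (h1 z hz)

/-- A polynomial of `I(h) + Q(g)` pairs nonnegatively with every feasible point of the relaxations
of sufficiently high order. -/
theorem eventually_riesz_nonneg_of_mem {p : MvPolynomial (Fin n) ℝ}
    (hp : p ∈ idealAddQuadModule h g) :
    ∀ᶠ k in Filter.atTop, ∀ z ∈ Phi g k ∩ Eset h k, 0 ≤ riesz p z := by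
  obtain ⟨a, ha, _, ⟨σ₀, σ, hσ₀, hσ, rfl⟩, rfl⟩ := hp
  obtain ⟨u, rfl⟩ := Ideal.mem_span_range_iff_exists_fun.1 ha
  have e1 : ∀ᶠ k in Filter.atTop, ∀ i, (h i).totalDegree + (u i).totalDegree ≤ k :=
    Filter.eventually_all.2 fun i => Filter.eventually_ge_atTop _
  have e2 := eventually_riesz_mul_nonneg (q := 1) hσ₀
  have e3 : ∀ᶠ k in Filter.atTop, ∀ j, ∀ z : Tms (expUpTo n (2 * k)),
      (locMatrix (g j) k z).PosSemidef → 0 ≤ riesz (g j * σ j) z :=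
    Filter.eventually_all.2 fun j => eventually_riesz_mul_nonneg (hσ j)
  filter_upwards [e1, e2, e3] with k h1 h2 h3 z hz
  rw [riesz_add_left, riesz_add_left, riesz_sum_left, riesz_sum_left]
  have h4 : ∑ i, riesz (u i * h i) z = 0 := Finset.sum_eq_zero fun i _ => by
    rw [mul_comm (u i)]
    exact riesz_mul_eq_zero (h1 i) (hz.2 i)
  have h5 := h2 z hz.1.1
  rw [one_mul] at h5
  rw [h4, zero_add]
  exact add_nonneg h5 (Finset.sum_nonneg fun j _ => h3 j z (hz.1.2 j))

theorem eventually_subset_expUpTo (A : Finset (Fin n →₀ ℕ)) :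
    ∀ᶠ k in Filter.atTop, A ⊆ expUpTo n (2 * k) := by
  filter_upwards [Filter.eventually_ge_atTop (A.sup Finsupp.degree)] with k hk α hα
  have : α.degree ≤ A.sup Finsupp.degree := Finset.le_sup (f := Finsupp.degree) hα
  rw [mem_expUpTo]
  omega

theorem IsArchimedean.eventually_riesz_nonneg (harch : IsArchimedean h g)
    {A : Finset (Fin n →₀ ℕ)} {p : MvPolynomial (Fin n) ℝ} (hpA : p.support ⊆ A)
    (hp : ∀ x ∈ semialgSet h g, 0 < eval x p) :
    ∀ᶠ k in Filter.atTop, ∀ y ∈ relaxCone A h g k, 0 ≤ riesz p y := by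
  filter_upwards [eventually_subset_expUpTo A,
    eventually_riesz_nonneg_of_mem (harch.mem_of_forall_eval_pos hp)] with k hA hk y hy
  obtain ⟨z, hz, rfl⟩ := hy hA
  rw [riesz_restrict hA hpA]
  exact hk z hz

end Relaxation

end MomentCone

/-! ### The normalized moment cone as a compact convex hull -/

namespace MomentCone

open MvPolynomial MeasureTheory

/-- The convex hull of a compact set in a finite-dimensional space is compact. -/
theorem isCompact_convexHull_of_finiteDimensional {E : Type*} [NormedAddCommGroup E]
    [NormedSpace ℝ E] [FiniteDimensional ℝ E] {s : Set E} (hs : IsCompact s) :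
    IsCompact (convexHull ℝ s) := by
  rcases s.eq_empty_or_nonempty with rfl | ⟨x₀, hx₀⟩
  · simp
  set d := Module.finrank ℝ E + 1
  have himage : convexHull ℝ s = (fun q : (Fin d → ℝ) × (Fin d → E) => ∑ i, q.1 i • q.2 i) ''
      (stdSimplex ℝ (Fin d) ×ˢ Set.univ.pi fun _ => s) := by
    apply Set.Subset.antisymm
    · intro x hx
      obtain ⟨ι, _, z, w, hz, hind, hw, hw1, rfl⟩ := eq_pos_convex_span_of_mem_convexHull hx
      have hcard : Fintype.card ι ≤ Fintype.card (Fin d) := by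
        rw [Fintype.card_fin]
        exact hind.card_le_finrank_succ.trans
          (Nat.succ_le_succ (Submodule.finrank_le _))
      obtain ⟨e⟩ := Function.Embedding.nonempty_of_card_le hcard
      have hext : ∀ i, Function.extend e w 0 (e i) = w i := e.injective.extend_apply w 0
      have hextz : ∀ i, Function.extend e z (fun _ => x₀) (e i) = z i :=
        e.injective.extend_apply z _
      have hext0 : ∀ j, j ∉ Set.range e → Function.extend e w 0 j = 0 := fun j hj =>
        Function.extend_apply' _ _ _ hj
      -- A Carathéodory combination is padded to exactly `d` terms with weight `0` at the point
      -- `x₀`.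
      refine ⟨(Function.extend e w 0, Function.extend e z fun _ => x₀), ⟨⟨fun j => ?_, ?_⟩,
        fun j _ => ?_⟩, ?_⟩
      · by_cases hj : j ∈ Set.range e
        · obtain ⟨i, rfl⟩ := hj
          exact (hw i).le.trans_eq (hext i).symm
        · exact (hext0 j hj).ge
      · rw [← hw1]
        exact (Fintype.sum_of_injective e e.injective _ _ hext0 fun i => (hext i).symm).symm
      · by_cases hj : j ∈ Set.range e
        · obtain ⟨i, rfl⟩ := hj
          simp only [hextz]
          exact hz ⟨i, rfl⟩
        · simp only [Function.extend_apply' _ _ _ hj]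
          exact hx₀
      · refine (Fintype.sum_of_injective e e.injective _ _ (fun j hj => ?_) fun i => ?_).symm
        · simp only [hext0 j hj, zero_smul]
        · simp only [hext, hextz]
    · rintro _ ⟨⟨w, z⟩, ⟨⟨hw, hw1⟩, hz⟩, rfl⟩
      exact (convex_convexHull ℝ s).sum_mem (fun i _ => hw i) hw1
        fun i _ => subset_convexHull ℝ s (hz i trivial)
  rw [himage]
  exact ((isCompact_stdSimplex ℝ (Fin d)).prod (isCompact_univ_pi fun _ => hs)).image (by fun_prop)

section Normalized

variable {n : ℕ} {A : Finset (Fin n →₀ ℕ)} {K : Set (Fin n → ℝ)} {f : MvPolynomial (Fin n) ℝ}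

theorem eval_eq_sum_of_support_subset {p : MvPolynomial (Fin n) ℝ} (hp : p.support ⊆ A)
    (x : Fin n → ℝ) :
    eval x p = ∑ α : A, coeff (α : Fin n →₀ ℕ) p * ∏ i, x i ^ (α : Fin n →₀ ℕ) i := by
  rw [eval_eq', Finset.sum_coe_sort A fun α => coeff α p * ∏ i, x i ^ α i]
  refine Finset.sum_subset hp fun α _ hα => ?_
  rw [notMem_support_iff.1 hα, zero_mul]

/-- The `A`-truncated moment sequence of the point mass at `x`, normalized by `f`. -/
noncomputable def normalizedMonomials (A : Finset (Fin n →₀ ℕ)) (f : MvPolynomial (Fin n) ℝ)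
    (x : Fin n → ℝ) : Tms A :=
  WithLp.toLp 2 fun α => (eval x f)⁻¹ * ∏ i, x i ^ (α : Fin n →₀ ℕ) i

theorem riesz_normalizedMonomials {p : MvPolynomial (Fin n) ℝ} (hp : p.support ⊆ A)
    (x : Fin n → ℝ) : riesz p (normalizedMonomials A f x) = (eval x f)⁻¹ * eval x p := by
  rw [eval_eq_sum_of_support_subset hp, Finset.mul_sum]
  exact Finset.sum_congr rfl fun α _ => by simp only [normalizedMonomials]; ring

theorem isCompact_convexHull_normalizedMonomials (hK : IsCompact K)
    (hf : ∀ x ∈ K, 0 < eval x f) :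
    IsCompact (convexHull ℝ (normalizedMonomials A f '' K)) := by
  refine isCompact_convexHull_of_finiteDimensional (hK.image_of_continuousOn ?_)
  refine (PiLp.continuous_toLp 2 _).comp_continuousOn (continuousOn_pi.2 fun α => ?_)
  exact ((continuous_eval f).continuousOn.inv₀ fun x hx => (hf x hx).ne').mul
    (by fun_prop : Continuous fun x : Fin n → ℝ => ∏ i, x i ^ (α : Fin n →₀ ℕ) i).continuousOn

/-- Separation: a point at which all positive polynomials are nonnegative is a convex combination
of normalized point evaluations. -/
theorem mem_convexHull_normalizedMonomials (hK : IsCompact K) (hf : ∀ x ∈ K, 0 < eval x f)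
    (hfA : f.support ⊆ A) {y : Tms A} (hy1 : riesz f y = 1)
    (hy : ∀ p : MvPolynomial (Fin n) ℝ, p.support ⊆ A → (∀ x ∈ K, 0 < eval x p) → 0 ≤ riesz p y) :
    y ∈ convexHull ℝ (normalizedMonomials A f '' K) := by
  classical
  by_contra hmem
  obtain ⟨l, u, hlt, hl⟩ := geometric_hahn_banach_point_closed (convex_convexHull ℝ _)
    (isCompact_convexHull_normalizedMonomials hK hf).isClosed hmem
  obtain ⟨p, hpA, hp⟩ := exists_riesz_eq l
  -- Multiplying `l > u` on normalized evaluations by `f > 0` makes `p - u f` positive on `K`, while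
  -- its pairing with `y` is `l y - u < 0`.
  have h1 := hy (p + (-u) • f) (support_add.trans (Finset.union_subset hpA
    (support_smul.trans hfA))) fun x hx => by
      have h2 := hl _ (subset_convexHull ℝ _ ⟨x, hx, rfl⟩)
      rw [← hp, riesz_normalizedMonomials hpA, inv_mul_eq_div, lt_div_iff₀ (hf x hx)] at h2
      rw [map_add, smul_eval]
      linarith
  rw [riesz_add_left, riesz_smul_left, hp, hy1] at h1
  linarith

theorem IsRepresenting.riesz_eq_integral {y : Tms A} {μ : Measure (Fin n → ℝ)}
    (hμ : IsRepresenting K y μ) {p : MvPolynomial (Fin n) ℝ} (hp : p.support ⊆ A) :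
    riesz p y = ∫ x, eval x p ∂μ := by
  simp_rw [eval_eq_sum_of_support_subset hp]
  rw [integral_finsetSum _ fun α _ => (hμ.2 α).1.const_mul _]
  exact Finset.sum_congr rfl fun α _ => by rw [integral_const_mul, (hμ.2 α).2]

theorem convex_momentCone : Convex ℝ (momentCone A K) := by
  rintro y ⟨μ, hμ, hμy⟩ y' ⟨μ', hμ', hμy'⟩ a b ha hb -
  refine ⟨ENNReal.ofReal a • μ + ENNReal.ofReal b • μ', by simp [hμ, hμ'], fun α => ?_⟩
  have h1 := (hμy α).1.smul_measure (c := ENNReal.ofReal a) ENNReal.ofReal_ne_top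
  have h2 := (hμy' α).1.smul_measure (c := ENNReal.ofReal b) ENNReal.ofReal_ne_top
  refine ⟨h1.add_measure h2, ?_⟩
  rw [integral_add_measure h1 h2, integral_smul_measure, integral_smul_measure,
    ENNReal.toReal_ofReal ha, ENNReal.toReal_ofReal hb, ← (hμy α).2, ← (hμy' α).2]
  rfl

theorem normalizedMonomials_mem_momentCone {x : Fin n → ℝ} (hx : x ∈ K) (hf : 0 < eval x f) :
    normalizedMonomials A f x ∈ momentCone A K := by
  refine ⟨ENNReal.ofReal (eval x f)⁻¹ • Measure.dirac x, ?_, fun α => ⟨?_, ?_⟩⟩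
  · rw [Measure.smul_apply, Measure.dirac_apply]
    simp [hx]
  · exact (integrable_dirac (by simp)).smul_measure ENNReal.ofReal_ne_top
  · rw [integral_smul_measure, integral_dirac, ENNReal.toReal_ofReal (inv_nonneg.2 hf.le)]
    rfl

/-- A representing measure integrates positive polynomials to nonnegative numbers, so separation
gives one inclusion; scaled point masses and convexity give the other. -/
theorem normalize_momentCone_eq (hK : IsCompact K) (hf : ∀ x ∈ K, 0 < eval x f)
    (hfA : f.support ⊆ A) :
    normalize (momentCone A K) f = convexHull ℝ (normalizedMonomials A f '' K) := by
  apply Set.Subset.antisymm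
  · rintro y ⟨⟨μ, hμ⟩, hy1⟩
    refine mem_convexHull_normalizedMonomials hK hf hfA hy1 fun p hpA hp => ?_
    rw [hμ.riesz_eq_integral hpA]
    refine integral_nonneg_of_ae ?_
    have hae : ∀ᵐ x ∂μ, x ∈ K := hμ.1
    filter_upwards [hae] with x hx using (hp x hx).le
  · refine convexHull_min ?_ ?_
    · rintro _ ⟨x, hx, rfl⟩
      refine ⟨normalizedMonomials_mem_momentCone hx (hf x hx), ?_⟩
      rw [riesz_normalizedMonomials hfA, inv_mul_cancel₀ (hf x hx).ne']
    · exact convex_momentCone.inter (convex_hyperplane (rieszRight f).isLinear 1)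

end Normalized

/-! ### Convergence of the relaxations -/

theorem oneSidedDist_le {n : ℕ} {A : Finset (Fin n →₀ ℕ)} {S T : Set (Tms A)} (hT : T.Nonempty)
    {r : ℝ} (h : ∀ z ∈ S, Metric.infDist z T < r) : oneSidedDist S T ≤ ENNReal.ofReal r := by
  refine iSup₂_le fun z hz => ?_
  obtain ⟨y, hy, hlt⟩ := (Metric.infDist_lt_iff hT).1 (h z hz)
  refine (iInf₂_le y hy).trans (ENNReal.ofReal_le_ofReal ?_)
  rw [← dist_eq_norm]
  exact hlt.le

/-- The normalized relaxations of sufficiently high order lie in any prescribed neighbourhood of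
the normalized moment cone. -/
theorem eventually_infDist_normalize_lt {n m₁ m₂ : ℕ} {h : Fin m₁ → MvPolynomial (Fin n) ℝ}
    {g : Fin m₂ → MvPolynomial (Fin n) ℝ} {A : Finset (Fin n →₀ ℕ)} (harch : IsArchimedean h g)
    {f : MvPolynomial (Fin n) ℝ} (hfA : f.support ⊆ A)
    (hf : ∀ x ∈ semialgSet h g, 0 < eval x f) {r : ℝ} (hr : 0 < r) :
    ∀ᶠ k in Filter.atTop, ∀ y ∈ normalize (relaxCone A h g k) f,
      Metric.infDist y (normalize (momentCone A (semialgSet h g)) f) < r := by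
  classical
  have hK := harch.isCompact_semialgSet
  have hT := isCompact_convexHull_normalizedMonomials (A := A) hK hf
  rw [normalize_momentCone_eq hK hf hfA]
  set T := convexHull ℝ (normalizedMonomials A f '' semialgSet h g)
  obtain ⟨B, hB⟩ := isBounded_iff_forall_norm_le.1 hT.isBounded
  let P := {p : MvPolynomial (Fin n) ℝ // p.support ⊆ A ∧ ∀ x ∈ semialgSet h g, 0 < eval x p}
  have hP : ∀ p : P, ∀ᶠ k in Filter.atTop, ∀ y ∈ relaxCone A h g k, 0 ≤ riesz p.1 y := fun p =>
    harch.eventually_riesz_nonneg p.2.1 p.2.2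
  -- Since `B` bounds the normalized evaluations, `(B + 1) f - e x^α` is positive on `K`; the `+ 1`
  -- makes this strict. The signs `e = ±1` bound each coordinate on both sides.
  have hbound : ∀ (α : A) (e : ℝ), |e| = 1 → ∀ᶠ k in Filter.atTop,
      ∀ y ∈ normalize (relaxCone A h g k) f, e * y α ≤ B + 1 := by
    intro α e he
    have hsupp : (monomial (α : Fin n →₀ ℕ) (1 : ℝ)).support ⊆ A :=
      support_monomial_subset.trans (Finset.singleton_subset_iff.2 α.2)
    have hpair : ∀ y : Tms A, riesz (monomial (α : Fin n →₀ ℕ) (1 : ℝ)) y = y α := fun y => by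
      rw [riesz, Finset.sum_eq_single α]
      · simp
      · intro β _ hβ
        rw [coeff_monomial, if_neg fun h => hβ (Subtype.ext h.symm), zero_mul]
      · simp
    have := harch.eventually_riesz_nonneg (p := (B + 1) • f + (-e) • monomial (α : Fin n →₀ ℕ) 1)
      (support_add.trans (Finset.union_subset (support_smul.trans hfA)
        (support_smul.trans hsupp))) fun x hx => by
        have h1 := hB _ (subset_convexHull ℝ _ ⟨x, hx, rfl⟩)
        have h2 : |e * normalizedMonomials A f x α| ≤ B := by
          rw [abs_mul, he, one_mul]
          exact (PiLp.norm_apply_le _ α).trans h1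
        have h3 : normalizedMonomials A f x α =
            (eval x f)⁻¹ * eval x (monomial (α : Fin n →₀ ℕ) 1) := by
          rw [← riesz_normalizedMonomials hsupp, hpair]
        have h4 := (le_abs_self _).trans h2
        rw [h3, inv_mul_eq_div, ← mul_div_assoc, div_le_iff₀ (hf x hx)] at h4
        rw [map_add, smul_eval, smul_eval]
        linarith [hf x hx]
    filter_upwards [this] with k hk y hy
    have h1 := hk y hy.1
    rw [riesz_add_left, riesz_smul_left, riesz_smul_left, hy.2, hpair] at h1
    linarith
  -- The bounded points of the hyperplane far from `T`. Compactness leaves finitely many polynomials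
  -- to exclude them, so a single threshold for `k` suffices.
  set Z : Set (Tms A) := {y | (∀ α, |y α| ≤ B + 1) ∧ riesz f y = 1 ∧ r ≤ Metric.infDist y T}
  have hZc : IsCompact Z := by
    refine Metric.isCompact_of_isClosed_isBounded (IsClosed.and ?_ (IsClosed.and ?_ ?_)) ?_
    · simp only [Set.ofPred_forall]
      exact isClosed_iInter fun α => isClosed_le (by fun_prop) continuous_const
    · exact isClosed_eq (rieszRight f).continuous continuous_const
    · exact isClosed_le continuous_const (Metric.continuous_infDist_pt T)
    · refine isBounded_iff_forall_norm_le.2 ⟨Real.sqrt (∑ _α : A, (B + 1) ^ 2), fun y hy => ?_⟩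
      rw [EuclideanSpace.norm_eq]
      refine Real.sqrt_le_sqrt (Finset.sum_le_sum fun α _ => ?_)
      rw [Real.norm_eq_abs]
      gcongr
      exact hy.1 α
  obtain ⟨s, hs⟩ := hZc.elim_finite_subfamily_closed (fun p : P => {y : Tms A | 0 ≤ riesz p.1 y})
    (fun p => isClosed_le continuous_const (rieszRight p.1).continuous) (by
      refine Set.eq_empty_of_forall_notMem ?_
      rintro y ⟨⟨-, hy1, hy2⟩, hy⟩
      have hyT : y ∈ T := mem_convexHull_normalizedMonomials hK hf hfA hy1 fun p hpA hp =>
        Set.mem_iInter.1 hy ⟨p, hpA, hp⟩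
      rw [Metric.infDist_zero_of_mem hyT] at hy2
      linarith)
  filter_upwards [(Filter.eventually_all_finset s).2 fun p _ => hP p,
    Filter.eventually_all.2 fun α => hbound α 1 (by simp),
    Filter.eventually_all.2 fun α => hbound α (-1) (by simp)] with k h1 h2 h3 y hy
  by_contra! hlt
  have hyZ : y ∈ Z := ⟨fun α => abs_le.2 ⟨by linarith [h3 α y hy], by linarith [h2 α y hy]⟩,
    hy.2, hlt⟩
  have hmem : y ∈ Z ∩ ⋂ p ∈ s, {y : Tms A | 0 ≤ riesz p.1 y} :=
    ⟨hyZ, Set.mem_iInter₂.2 fun p hp => h1 p hp y hy.1⟩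
  rw [hs] at hmem
  exact hmem

end MomentCone

theorem mainTheorem6 {n m₁ m₂ : ℕ}
    (h : Fin m₁ → MvPolynomial (Fin n) ℝ) (g : Fin m₂ → MvPolynomial (Fin n) ℝ)
    (A : Finset (Fin n →₀ ℕ))
    (hK : (MomentCone.semialgSet h g).Nonempty)
    (harch : MomentCone.IsArchimedean h g)
    (f : MvPolynomial (Fin n) ℝ) (hfA : f ∈ MomentCone.polySpan A)
    (hfK : ∀ x ∈ MomentCone.semialgSet h g, 0 < MvPolynomial.eval x f) :
    (∀ z : MomentCone.Tms A,
      ∃ y ∈ MomentCone.normalize (MomentCone.momentCone A (MomentCone.semialgSet h g)) f,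
        ∀ y' ∈ MomentCone.normalize (MomentCone.momentCone A (MomentCone.semialgSet h g)) f,
          ‖z - y‖ ≤ ‖z - y'‖) ∧
    Filter.Tendsto
      (fun k : ℕ => MomentCone.oneSidedDist
        (MomentCone.normalize (MomentCone.relaxCone A h g k) f)
        (MomentCone.normalize (MomentCone.momentCone A (MomentCone.semialgSet h g)) f))
      Filter.atTop (nhds 0) := by
  have hsupp := MomentCone.support_subset_of_mem_polySpan hfA
  have hcpt := harch.isCompact_semialgSet
  have heq := MomentCone.normalize_momentCone_eq hcpt hfK hsupp
  have hTc : IsCompact (MomentCone.normalize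
      (MomentCone.momentCone A (MomentCone.semialgSet h g)) f) := by
    rw [heq]
    exact MomentCone.isCompact_convexHull_normalizedMonomials hcpt hfK
  have hTn : (MomentCone.normalize
      (MomentCone.momentCone A (MomentCone.semialgSet h g)) f).Nonempty := by
    rw [heq]
    exact (hK.image _).convexHull
  refine ⟨fun z => ?_, ?_⟩
  · obtain ⟨y, hy, hmin⟩ := hTc.exists_isMinOn hTn
      (f := fun y => ‖z - y‖) (by fun_prop)
    exact ⟨y, hy, fun y' hy' => hmin hy'⟩
  · refine ENNReal.tendsto_nhds_zero.2 fun ε hε => ?_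
    obtain ⟨r, hr, hrε⟩ := ENNReal.lt_iff_exists_nnreal_btwn.1 hε
    filter_upwards [MomentCone.eventually_infDist_normalize_lt harch hsupp hfK
      (r := r) (by exact_mod_cast hr)] with k hk
    refine (MomentCone.oneSidedDist_le hTn hk).trans ?_
    rw [ENNReal.ofReal_coe_nnreal]
    exact hrε.le
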